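/- **Theorem 7.** Let $\mathcal H^A,\mathcal H^B$ be finite-dimensional complex Hilbert spaces with fixed orthonormal (``incoherent'') bases $\{|x\rangle^A\}$, $\{|y\rangle^B\}$; composite local systems carry the product bases, and every further local system comes with its own fixed incoherent basis. A state is incoherent if its density matrix is diagonal in the incoherent basis, and an operator $K$ from one such system to another is incoherent if $K\sigma K^\dagger$ is diagonal for every incoherent state $\sigma$. An LOCC map is a map realized by a finite number of rounds in each of which one of the two parties, Alice or Bob, applies to her or his own system a measurement given by a finite family of Kraus operators $\{K_i\}$ with $\sum_i K_i^\dagger K_i=\mathbb I$ (the output space may differ from the input space) and announces the outcome $i$, on which all later rounds may depend; the output is the sum over all measurement records of the unnormalized final states. It is an LIOCC map if all Kraus operators used are incoherent. Let $\Phi_{AB}$ be the projector onto $\tfrac1{\sqrt2}(|00\rangle+|11\rangle)$ in $\mathbb C^2\otimes\mathbb C^2$ (with the computational bases as incoherent bases). Say that entanglement can be distilled from a state $\rho^{AB}$ by LOCC (respectively LIOCC) if for every $\epsilon>0$ there are $n\in\mathbb N$ and an LOCC (respectively LIOCC) map $\mathcal L$ from $n$ copies of $AB$ to two qubits such that $\tfrac12\|\mathcal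 L(\rho^{\otimes n})-\Phi_{AB}\|_1\le\epsilon$. Then, for every density matrix $\rho^{AB}$ on $\mathcal H^A\otimes\mathcal H^B$, entanglement can be distilled from $\rho^{AB}$ by LOCC if and only if entanglement can be distilled from $\rho^{AB}$ by LIOCC. -/

import Mathlib

open scoped Kronecker ComplexOrder

/-- A density matrix on the system whose incoherent (reference) basis is indexed by `S`. -/
def IsDensity {S : Type} [Fintype S] (ρ : Matrix S S ℂ) : Prop :=
  ρ.PosSemidef ∧ ρ.trace = 1

/-- An incoherent state: a density matrix that is diagonal in the incoherent basis. -/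
def IsIncoherentState {S : Type} [Fintype S] (σ : Matrix S S ℂ) : Prop :=
  IsDensity σ ∧ σ.IsDiag

/-- `K σ Kᴴ` is diagonal, hence proportional to an incoherent state, for each incoherent `σ`. -/
def IsIncoherentKraus {S T : Type} [Fintype S] (K : Matrix T S ℂ) : Prop :=
  ∀ σ : Matrix S S ℂ, IsIncoherentState σ → (K * σ * K.conjTranspose).IsDiag

/-- A class of Kraus operators that the parties may use in their laboratories. -/
abbrev KrausClass : Type 1 :=
  ∀ (S T : Type) [Fintype S], Matrix T S ℂ → Prop

/-- All Kraus operators. -/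
def allKraus : KrausClass := fun _ _ _ _ => True

/-- The incoherent Kraus operators. -/
def incoherentKraus : KrausClass := fun _ _ _ K => IsIncoherentKraus K

/-- The maps realised by finite-round protocols of local operations from the class `𝒦` and classical
communication, with output systems `A'` and `B'`. In one round, one party performs a complete
measurement with Kraus operators in `𝒦` (possibly changing the local system: ancillas may be added
and subsystems discarded) and announces the outcome `i`; the protocol `L i` that follows may depend
on it. The output is the sum over all measurement records of the unnormalised final states. -/
inductive IsProtocol (𝒦 : KrausClass) {A' B' : Type} [Fintype A'] [DecidableEq A']
    [Fintype B'] [DecidableEq B'] :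
    ∀ (A B : Type) [Fintype A] [DecidableEq A] [Fintype B] [DecidableEq B],
      (Matrix (A × B) (A × B) ℂ → Matrix (A' × B') (A' × B') ℂ) → Prop
  | done : IsProtocol 𝒦 A' B' (fun ρ => ρ)
  | alice {A B A₁ ι : Type} [Fintype A] [DecidableEq A] [Fintype B] [DecidableEq B]
      [Fintype A₁] [DecidableEq A₁] [Fintype ι] (K : ι → Matrix A₁ A ℂ)
      (complete : ∑ i, (K i).conjTranspose * K i = 1) (mem : ∀ i, 𝒦 A A₁ (K i))
      (L : ι → Matrix (A₁ × B) (A₁ × B) ℂ → Matrix (A' × B') (A' × B') ℂ)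
      (next : ∀ i, IsProtocol 𝒦 A₁ B (L i)) :
      IsProtocol 𝒦 A B (fun ρ => ∑ i, L i
        ((K i ⊗ₖ (1 : Matrix B B ℂ)) * ρ * (K i ⊗ₖ (1 : Matrix B B ℂ)).conjTranspose))
  | bob {A B B₁ ι : Type} [Fintype A] [DecidableEq A] [Fintype B] [DecidableEq B]
      [Fintype B₁] [DecidableEq B₁] [Fintype ι] (K : ι → Matrix B₁ B ℂ)
      (complete : ∑ i, (K i).conjTranspose * K i = 1) (mem : ∀ i, 𝒦 B B₁ (K i))
      (L : ι → Matrix (A × B₁) (A × B₁) ℂ → Matrix (A' × B') (A' × B') ℂ)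
      (next : ∀ i, IsProtocol 𝒦 A B₁ (L i)) :
      IsProtocol 𝒦 A B (fun ρ => ∑ i, L i
        (((1 : Matrix A A ℂ) ⊗ₖ K i) * ρ * ((1 : Matrix A A ℂ) ⊗ₖ K i).conjTranspose))

/-- `n` copies of a bipartite state. Alice holds the `n` copies of `A`, Bob those of `B`, each with
the product incoherent basis. -/
def copies {A B : Type} (n : ℕ) (ρ : Matrix (A × B) (A × B) ℂ) :
    Matrix ((Fin n → A) × (Fin n → B)) ((Fin n → A) × (Fin n → B)) ℂ :=
  fun x y => ∏ i, ρ (x.1 i, x.2 i) (y.1 i, y.2 i)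

/-- The vector `(|00⟩ + |11⟩) / √2`. -/
noncomputable def ebitVec : Fin 2 × Fin 2 → ℂ :=
  fun x => if x.1 = x.2 then ((1 / Real.sqrt 2 : ℝ) : ℂ) else 0

/-- The maximally entangled two-qubit state `|Φ⟩⟨Φ|`, `Φ = (|00⟩ + |11⟩) / √2`. -/
noncomputable def ebit : Matrix (Fin 2 × Fin 2) (Fin 2 × Fin 2) ℂ :=
  Matrix.vecMulVec ebitVec (star ebitVec)

/-- The trace norm `tr √(Mᴴ M)`, i.e. the sum of the singular values of `M`. -/
noncomputable def traceNorm {S : Type} [Fintype S] [DecidableEq S] (M : Matrix S S ℂ) : ℝ :=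
  ∑ i, Real.sqrt ((Matrix.isHermitian_conjTranspose_mul_self M).eigenvalues i)

/-- The trace distance `‖ρ - σ‖₁ / 2`. -/
noncomputable def traceDist {S : Type} [Fintype S] [DecidableEq S] (ρ σ : Matrix S S ℂ) : ℝ :=
  traceNorm (ρ - σ) / 2

/-- Entanglement can be distilled from `ρ` with local operations from `𝒦` and classical
communication: to every accuracy, some number of copies of `ρ` is transformed into `ebit`. -/
def Distillable (𝒦 : KrausClass) {A B : Type} [Fintype A] [DecidableEq A] [Fintype B]
    [DecidableEq B] (ρ : Matrix (A × B) (A × B) ℂ) : Prop :=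
  ∀ ε : ℝ, 0 < ε → ∃ (n : ℕ)
    (L : Matrix ((Fin n → A) × (Fin n → B)) ((Fin n → A) × (Fin n → B)) ℂ →
      Matrix (Fin 2 × Fin 2) (Fin 2 × Fin 2) ℂ),
    IsProtocol 𝒦 (Fin n → A) (Fin n → B) L ∧ traceDist (L (copies n ρ)) ebit ≤ ε

/-- Distillability by local operations and classical communication. -/
def LOCCDistillable {A B : Type} [Fintype A] [DecidableEq A] [Fintype B] [DecidableEq B]
    (ρ : Matrix (A × B) (A × B) ℂ) : Prop :=
  Distillable allKraus ρ

/-- Distillability by local incoherent operations and classical communication. -/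
def LIOCCDistillable {A B : Type} [Fintype A] [DecidableEq A] [Fintype B] [DecidableEq B]
    (ρ : Matrix (A × B) (A × B) ℂ) : Prop :=
  Distillable incoherentKraus ρ

open Matrix

/-! Incoherent protocols form a subclass of all protocols, so only one direction needs work. A
protocol is a sum, over measurement records, of product filters (`IsProtocol.exists_kraus`). If its
output is near the ebit, averaging yields a single record `M ⊗ N` of positive probability whose
normalised output is near the ebit (`LOCCDistillable.exists_branch`). It remains to imitate this one
filter by incoherent operators and to repeat it.

The imitation spends additional copies. If `ρ` were block diagonal in Alice's basis, every filtered
state would have positive partial transpose and hence overlap at most 1/2 with the ebit; likewise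
for Bob. So `ρ` has coherence on both sides, and `exists_coherent_filter` converts copies of it into
operators that tend, after rescaling, to the all-ones matrix, using an incoherent operator on the
chosen side. The row-wise product `faceSplit` of filters produces the Hadamard product of their
outputs (`localFilter_faceSplit`) and is incoherent as soon as one factor is column-disjoint. Since
the all-ones matrix is neutral for the Hadamard product, attaching one coherence filter for Alice
and one for Bob makes both operators incoherent and leaves the rescaled output unchanged in the
limit (`LOCCDistillable.exists_incoherent_branch`).

A positive multiple of each operator belongs to an incoherent measurement
(`ColumnDisjoint.exists_measurement`). Its success probability may be tiny, but it is positive, and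
repetition on fresh copies makes failure negligible (`exists_repeated_protocol`). -/

/-- The unnormalised state after the parties have obtained outcomes with Kraus operators `K`, `L`. -/
def localFilter {X Y X' Y' : Type} [Fintype X] [Fintype Y]
    (K : Matrix X' X ℂ) (L : Matrix Y' Y ℂ) (σ : Matrix (X × Y) (X × Y) ℂ) :
    Matrix (X' × Y') (X' × Y') ℂ :=
  (K ⊗ₖ L) * σ * (K ⊗ₖ L)ᴴ

/-! ### Calculus of product filters -/

section LocalFilter

variable {X Y X' Y' X'' Y'' : Type} [Fintype X] [Fintype Y]

theorem localFilter_apply (K : Matrix X' X ℂ) (L : Matrix Y' Y ℂ)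
    (σ : Matrix (X × Y) (X × Y) ℂ) (i k : X') (j l : Y') :
    localFilter K L σ (i, j) (k, l) =
      ∑ p, ∑ q, K i p.1 * L j p.2 * σ p q * (star (K k q.1) * star (L l q.2)) := by
  simp only [localFilter, Matrix.mul_apply, conjTranspose_apply, kroneckerMap_apply, star_mul',
    Finset.sum_mul]
  exact Finset.sum_comm

theorem localFilter_localFilter [Fintype X'] [Fintype Y']
    (K : Matrix X' X ℂ) (L : Matrix Y' Y ℂ) (M : Matrix X'' X' ℂ) (N : Matrix Y'' Y' ℂ)
    (σ : Matrix (X × Y) (X × Y) ℂ) :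
    localFilter M N (localFilter K L σ) = localFilter (M * K) (N * L) σ := by
  simp only [localFilter, mul_kronecker_mul, conjTranspose_mul, Matrix.mul_assoc]

theorem localFilter_posSemidef [Fintype X'] [Fintype Y']
    {σ : Matrix (X × Y) (X × Y) ℂ} (hσ : σ.PosSemidef)
    (K : Matrix X' X ℂ) (L : Matrix Y' Y ℂ) : (localFilter K L σ).PosSemidef :=
  hσ.mul_mul_conjTranspose_same _

theorem localFilter_smul_left (c : ℂ) (K : Matrix X' X ℂ) (L : Matrix Y' Y ℂ)
    (σ : Matrix (X × Y) (X × Y) ℂ) :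
    localFilter (c • K) L σ = (c * star c) • localFilter K L σ := by
  simp only [localFilter, smul_kronecker, conjTranspose_smul, Matrix.smul_mul, Matrix.mul_smul,
    smul_smul]
  rw [mul_comm]

theorem localFilter_smul_right (c : ℂ) (K : Matrix X' X ℂ) (L : Matrix Y' Y ℂ)
    (σ : Matrix (X × Y) (X × Y) ℂ) :
    localFilter K (c • L) σ = (c * star c) • localFilter K L σ := by
  simp only [localFilter, kronecker_smul, conjTranspose_smul, Matrix.smul_mul, Matrix.mul_smul,
    smul_smul]
  rw [mul_comm]

theorem localFilter_smul (c : ℂ) (K : Matrix X' X ℂ) (L : Matrix Y' Y ℂ)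
    (σ : Matrix (X × Y) (X × Y) ℂ) :
    localFilter K L (c • σ) = c • localFilter K L σ := by
  simp only [localFilter, Matrix.smul_mul, Matrix.mul_smul]

theorem localFilter_swap (K : Matrix X' X ℂ) (L : Matrix Y' Y ℂ)
    (σ : Matrix (X × Y) (X × Y) ℂ) :
    localFilter L K (σ.submatrix Prod.swap Prod.swap) =
      (localFilter K L σ).submatrix Prod.swap Prod.swap := by
  ext ⟨i, j⟩ ⟨k, l⟩
  simp only [submatrix_apply, Prod.swap_prod_mk, localFilter_apply]
  refine Fintype.sum_equiv (Equiv.prodComm _ _) _ _ fun p => ?_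
  refine Fintype.sum_equiv (Equiv.prodComm _ _) _ _ fun q => ?_
  simp only [Equiv.prodComm_apply, Prod.fst_swap, Prod.snd_swap]
  ring

/-- Trace preservation for a complete family of product Kraus operators. -/
theorem trace_sum_localFilter [Fintype X'] [Fintype Y'] {κ : Type} [Fintype κ]
    [DecidableEq X] [DecidableEq Y]
    {K : κ → Matrix X' X ℂ} {L : κ → Matrix Y' Y ℂ}
    (h : ∑ r, (K r ⊗ₖ L r)ᴴ * (K r ⊗ₖ L r) = 1) (σ : Matrix (X × Y) (X × Y) ℂ) :
    (∑ r, localFilter (K r) (L r) σ).trace = σ.trace := by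
  have : ∀ r, (localFilter (K r) (L r) σ).trace
      = ((K r ⊗ₖ L r)ᴴ * (K r ⊗ₖ L r) * σ).trace := fun r => by
    rw [localFilter, Matrix.trace_mul_comm, ← Matrix.mul_assoc]
  rw [Matrix.trace_sum, Finset.sum_congr rfl fun r _ => this r, ← Matrix.trace_sum,
    ← Matrix.sum_mul, h, Matrix.one_mul]

end LocalFilter

theorem sum_kronecker_one {ι S T R : Type} [Fintype ι] [Fintype S] [DecidableEq S] [Fintype T]
    [Fintype R] [DecidableEq R] {K : ι → Matrix T S ℂ} (hK : ∑ i, (K i)ᴴ * K i = 1) :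
    ∑ i, (K i ⊗ₖ (1 : Matrix R R ℂ))ᴴ * (K i ⊗ₖ (1 : Matrix R R ℂ)) = 1 := by
  simp only [conjTranspose_kronecker, ← mul_kronecker_mul, conjTranspose_one, Matrix.mul_one]
  rw [← one_kronecker_one, ← hK]
  ext ⟨a, b⟩ ⟨c, d⟩
  simp [Matrix.sum_apply, Finset.sum_mul]

/-! ### Protocols as families of product Kraus operators -/

section Protocols

variable {𝒦 : KrausClass} {A' B' A B : Type} [Fintype A'] [DecidableEq A'] [Fintype B']
  [DecidableEq B'] [Fintype A] [DecidableEq A] [Fintype B] [DecidableEq B]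

/-- Every protocol acts as a complete family of product Kraus operators, one per record. -/
theorem IsProtocol.exists_kraus
    {L : Matrix (A × B) (A × B) ℂ → Matrix (A' × B') (A' × B') ℂ} (h : IsProtocol 𝒦 A B L) :
    ∃ (κ : Type) (_ : Fintype κ) (M : κ → Matrix A' A ℂ) (N : κ → Matrix B' B ℂ),
      (∀ ρ, L ρ = ∑ r, localFilter (M r) (N r) ρ) ∧
        ∑ r, (M r ⊗ₖ N r)ᴴ * (M r ⊗ₖ N r) = 1 := by
  induction h with
  | done =>
    exact ⟨Unit, inferInstance, fun _ => 1, fun _ => 1, fun ρ => by simp [localFilter], by simp⟩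
  | @alice A B A₁ ι _ _ _ _ _ _ _ K complete mem L next ih =>
    choose κ hκ M N hL hMN using ih
    refine ⟨Σ i, κ i, inferInstance, fun r => M r.1 r.2 * K r.1, fun r => N r.1 r.2,
      fun ρ => ?_, ?_⟩
    · rw [Fintype.sum_sigma]
      refine Finset.sum_congr rfl fun i _ => ?_
      rw [hL]
      refine Finset.sum_congr rfl fun r _ => ?_
      change localFilter _ _ (localFilter _ _ _) = _
      rw [localFilter_localFilter, Matrix.mul_one]
    · rw [Fintype.sum_sigma]
      have : ∀ i r, (((M i r * K i) ⊗ₖ N i r)ᴴ * ((M i r * K i) ⊗ₖ N i r))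
          = (K i ⊗ₖ (1 : Matrix B B ℂ))ᴴ * ((M i r ⊗ₖ N i r)ᴴ * (M i r ⊗ₖ N i r)) *
            (K i ⊗ₖ (1 : Matrix B B ℂ)) := fun i r => by
        conv_lhs => rw [← Matrix.mul_one (N i r), mul_kronecker_mul, conjTranspose_mul]
        simp only [Matrix.mul_assoc]
      simp only [this, ← Matrix.mul_sum, ← Matrix.sum_mul, hMN, Matrix.mul_one]
      exact sum_kronecker_one complete
  | @bob A B B₁ ι _ _ _ _ _ _ _ K complete mem L next ih =>
    choose κ hκ M N hL hMN using ih
    refine ⟨Σ i, κ i, inferInstance, fun r => M r.1 r.2, fun r => N r.1 r.2 * K r.1,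
      fun ρ => ?_, ?_⟩
    · rw [Fintype.sum_sigma]
      refine Finset.sum_congr rfl fun i _ => ?_
      rw [hL]
      refine Finset.sum_congr rfl fun r _ => ?_
      change localFilter _ _ (localFilter _ _ _) = _
      rw [localFilter_localFilter, Matrix.mul_one]
    · rw [Fintype.sum_sigma]
      have : ∀ i r, ((M i r ⊗ₖ (N i r * K i))ᴴ * (M i r ⊗ₖ (N i r * K i)))
          = ((1 : Matrix A A ℂ) ⊗ₖ K i)ᴴ * ((M i r ⊗ₖ N i r)ᴴ * (M i r ⊗ₖ N i r)) *
            ((1 : Matrix A A ℂ) ⊗ₖ K i) := fun i r => by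
        conv_lhs => rw [← Matrix.mul_one (M i r), mul_kronecker_mul, conjTranspose_mul]
        simp only [Matrix.mul_assoc]
      simp only [this, ← Matrix.mul_sum, ← Matrix.sum_mul, hMN, Matrix.mul_one]
      simp only [conjTranspose_kronecker, ← mul_kronecker_mul, conjTranspose_one, Matrix.mul_one]
      rw [← one_kronecker_one, ← complete]
      ext ⟨a, b⟩ ⟨c, d⟩
      simp [Matrix.sum_apply, Finset.mul_sum]

theorem IsProtocol.isDensity
    {L : Matrix (A × B) (A × B) ℂ → Matrix (A' × B') (A' × B') ℂ} (h : IsProtocol 𝒦 A B L)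
    {ρ : Matrix (A × B) (A × B) ℂ} (hρ : IsDensity ρ) : IsDensity (L ρ) := by
  obtain ⟨κ, _, M, N, hL, hMN⟩ := h.exists_kraus
  rw [hL]
  exact ⟨posSemidef_sum _ fun r _ => localFilter_posSemidef hρ.1 _ _,
    (trace_sum_localFilter hMN ρ).trans hρ.2⟩

theorem IsProtocol.map_smul
    {L : Matrix (A × B) (A × B) ℂ → Matrix (A' × B') (A' × B') ℂ} (h : IsProtocol 𝒦 A B L)
    (c : ℂ) (ρ : Matrix (A × B) (A × B) ℂ) : L (c • ρ) = c • L ρ := by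
  obtain ⟨κ, _, M, N, hL, -⟩ := h.exists_kraus
  simp only [hL, localFilter_smul, Finset.smul_sum]

/-- Enlarging the class of Kraus operators enlarges the class of protocols. -/
theorem IsProtocol.mono {𝒦' : KrausClass}
    (h𝒦 : ∀ (S T : Type) [Fintype S] (K : Matrix T S ℂ), 𝒦 S T K → 𝒦' S T K)
    {L : Matrix (A × B) (A × B) ℂ → Matrix (A' × B') (A' × B') ℂ} (h : IsProtocol 𝒦 A B L) :
    IsProtocol 𝒦' A B L := by
  induction h with
  | done => exact .done
  | alice K complete mem L next ih => exact .alice K complete (fun i => h𝒦 _ _ _ (mem i)) L ih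
  | bob K complete mem L next ih => exact .bob K complete (fun i => h𝒦 _ _ _ (mem i)) L ih

/-- A round of Alice followed by a round of Bob. -/
theorem IsProtocol.measure {A₁ B₁ ι κ : Type} [Fintype A₁] [DecidableEq A₁] [Fintype B₁]
    [DecidableEq B₁] [Fintype ι] [Fintype κ]
    (K : ι → Matrix A₁ A ℂ) (hK : ∑ i, (K i)ᴴ * K i = 1) (mK : ∀ i, 𝒦 A A₁ (K i))
    (M : κ → Matrix B₁ B ℂ) (hM : ∑ j, (M j)ᴴ * M j = 1) (mM : ∀ j, 𝒦 B B₁ (M j))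
    {L : ι → κ → Matrix (A₁ × B₁) (A₁ × B₁) ℂ → Matrix (A' × B') (A' × B') ℂ}
    (hL : ∀ i j, IsProtocol 𝒦 A₁ B₁ (L i j)) :
    IsProtocol 𝒦 A B (fun ρ => ∑ i, ∑ j, L i j (localFilter (K i) (M j) ρ)) := by
  have key := IsProtocol.alice (A := A) (B := B) (A' := A') (B' := B') K hK mK _
    fun i => IsProtocol.bob M hM mM _ (hL i)
  convert key using 6 with ρ i _ j
  change _ = localFilter _ _ (localFilter _ _ _)
  rw [localFilter_localFilter, Matrix.one_mul, Matrix.mul_one]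

end Protocols

/-! ### Trace norm against matrix entries -/

section TraceNorm

variable {S : Type} [Fintype S]

theorem sum_norm_sq_eq_sum_eigenvalues [DecidableEq S] (M : Matrix S S ℂ) :
    ∑ i, ∑ j, ‖M i j‖ ^ 2 = ∑ i, (isHermitian_conjTranspose_mul_self M).eigenvalues i := by
  have h := (isHermitian_conjTranspose_mul_self M).trace_eq_sum_eigenvalues
  have h2 : (Mᴴ * M).trace = ((∑ i, ∑ j, ‖M i j‖ ^ 2 : ℝ) : ℂ) := by
    rw [Finset.sum_comm]
    simp only [Matrix.trace, Matrix.diag_apply, Matrix.mul_apply, conjTranspose_apply,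
      Complex.ofReal_sum, Complex.ofReal_pow]
    refine Finset.sum_congr rfl fun i _ => Finset.sum_congr rfl fun j _ => ?_
    exact Complex.conj_mul' _
  rw [h2] at h
  refine Complex.ofReal_injective (h.trans ?_)
  rw [Complex.ofReal_sum]
  rfl

/-- An entry is bounded by the Frobenius norm, the ℓ² norm of the singular values, which is at most
their ℓ¹ norm. -/
theorem norm_apply_le_traceNorm [DecidableEq S] (M : Matrix S S ℂ) (i j : S) :
    ‖M i j‖ ≤ traceNorm M := by
  have hnn := eigenvalues_conjTranspose_mul_self_nonneg M
  have h0 : 0 ≤ traceNorm M := Finset.sum_nonneg fun i _ => Real.sqrt_nonneg _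
  refine le_of_sq_le_sq ?_ h0
  calc ‖M i j‖ ^ 2 ≤ ∑ j, ‖M i j‖ ^ 2 :=
        Finset.single_le_sum (f := fun j => ‖M i j‖ ^ 2) (fun _ _ => by positivity)
          (Finset.mem_univ j)
    _ ≤ ∑ i, ∑ j, ‖M i j‖ ^ 2 :=
        Finset.single_le_sum (f := fun i => ∑ j, ‖M i j‖ ^ 2) (fun _ _ => by positivity)
          (Finset.mem_univ i)
    _ = ∑ i, Real.sqrt ((isHermitian_conjTranspose_mul_self M).eigenvalues i) ^ 2 := by
        rw [sum_norm_sq_eq_sum_eigenvalues]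
        exact Finset.sum_congr rfl fun i _ => (Real.sq_sqrt (hnn i)).symm
    _ ≤ traceNorm M ^ 2 := Finset.sum_sq_le_sq_sum_of_nonneg fun i _ => Real.sqrt_nonneg _

/-- Cauchy–Schwarz on the singular values. -/
theorem traceNorm_sq_le [DecidableEq S] (M : Matrix S S ℂ) :
    traceNorm M ^ 2 ≤ Fintype.card S * ∑ i, ∑ j, ‖M i j‖ ^ 2 := by
  have hnn := eigenvalues_conjTranspose_mul_self_nonneg M
  have := sq_sum_le_card_mul_sum_sq (s := Finset.univ)
    (f := fun i => Real.sqrt ((isHermitian_conjTranspose_mul_self M).eigenvalues i))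
  rw [sum_norm_sq_eq_sum_eigenvalues]
  refine this.trans_eq ?_
  rw [Finset.card_univ]
  congr 1
  exact Finset.sum_congr rfl fun i _ => Real.sq_sqrt (hnn i)

theorem Matrix.PosSemidef.exists_conjTranspose_mul_self {M : Matrix S S ℂ} (hM : M.PosSemidef) :
    ∃ R : Matrix S S ℂ, M = Rᴴ * R := by
  classical
  open scoped MatrixOrder Matrix.Norms.L2Operator in
  exact CStarAlgebra.nonneg_iff_eq_star_mul_self.mp hM.nonneg

/-- Cauchy–Schwarz for the columns of `R`, whose Gram matrix is `M`. -/
theorem Matrix.PosSemidef.norm_apply_sq_le {M : Matrix S S ℂ} (hM : M.PosSemidef) (i j : S) :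
    ‖M i j‖ ^ 2 ≤ (M i i).re * (M j j).re := by
  obtain ⟨R, rfl⟩ := hM.exists_conjTranspose_mul_self
  let v : S → EuclideanSpace ℂ S := fun i => WithLp.toLp 2 fun k => R k i
  have hv : ∀ i j, (Rᴴ * R) i j = inner ℂ (v i) (v j) := fun i j => by
    simp [v, Matrix.mul_apply, PiLp.inner_apply, mul_comm]
  rw [hv, hv, hv]
  have h1 : ∀ i, (inner ℂ (v i) (v i)).re = ‖v i‖ ^ 2 := fun i => by
    rw [inner_self_eq_norm_sq_to_K]; norm_cast
  rw [h1, h1, ← mul_pow]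
  exact pow_le_pow_left₀ (norm_nonneg _) (norm_inner_le_norm _ _) 2

theorem IsDensity.sum_norm_sq_le_one {M : Matrix S S ℂ} (hM : IsDensity M) :
    ∑ i, ∑ j, ‖M i j‖ ^ 2 ≤ 1 := by
  have ht : ∑ i, (M i i).re = 1 := by
    have := congrArg Complex.re hM.2
    simpa [Matrix.trace] using this
  calc ∑ i, ∑ j, ‖M i j‖ ^ 2 ≤ ∑ i, ∑ j, (M i i).re * (M j j).re :=
        Finset.sum_le_sum fun i _ => Finset.sum_le_sum fun j _ => hM.1.norm_apply_sq_le i j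
    _ = 1 := by rw [← Finset.sum_mul_sum, ht, one_mul]

end TraceNorm

/-! ### Overlap with the ebit -/

section Fidelity

/-- The overlap `⟨Φ|S|Φ⟩` of a two-qubit operator with the maximally entangled state. -/
noncomputable def ebitFidelity (S : Matrix (Fin 2 × Fin 2) (Fin 2 × Fin 2) ℂ) : ℝ :=
  (S (0, 0) (0, 0) + S (0, 0) (1, 1) + S (1, 1) (0, 0) + S (1, 1) (1, 1)).re / 2

theorem ebitFidelity_sum {α : Type} (s : Finset α)
    (S : α → Matrix (Fin 2 × Fin 2) (Fin 2 × Fin 2) ℂ) :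
    ebitFidelity (∑ a ∈ s, S a) = ∑ a ∈ s, ebitFidelity (S a) := by
  simp only [ebitFidelity, Matrix.sum_apply, Complex.add_re, Complex.re_sum,
    ← Finset.sum_add_distrib, Finset.sum_div]

theorem ebitFidelity_add (S T : Matrix (Fin 2 × Fin 2) (Fin 2 × Fin 2) ℂ) :
    ebitFidelity (S + T) = ebitFidelity S + ebitFidelity T := by
  simp only [ebitFidelity, Matrix.add_apply, Complex.add_re]
  ring

theorem ebitFidelity_smul (c : ℝ) (S : Matrix (Fin 2 × Fin 2) (Fin 2 × Fin 2) ℂ) :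
    ebitFidelity ((c : ℂ) • S) = c * ebitFidelity S := by
  simp only [ebitFidelity, Matrix.smul_apply, smul_eq_mul, Complex.add_re, Complex.re_ofReal_mul]
  ring

theorem ebitFidelity_nonneg {S : Matrix (Fin 2 × Fin 2) (Fin 2 × Fin 2) ℂ} (hS : S.PosSemidef) :
    0 ≤ ebitFidelity S := by
  have h := hS.dotProduct_mulVec_nonneg (fun p => if p.1 = p.2 then 1 else 0)
  have h2 := (Complex.le_def.1 h).1
  simp [dotProduct, mulVec, Fintype.sum_prod_type, Fin.sum_univ_two] at h2
  simp only [ebitFidelity, Complex.add_re]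
  linarith

theorem ebit_apply (i j : Fin 2 × Fin 2) :
    ebit i j = if i.1 = i.2 ∧ j.1 = j.2 then 1 / 2 else 0 := by
  have h : ((Real.sqrt 2 : ℝ) : ℂ) * ((Real.sqrt 2 : ℝ) : ℂ) = 2 := by
    rw [← Complex.ofReal_mul, Real.mul_self_sqrt (by norm_num)]; norm_num
  simp only [ebit, vecMulVec_apply, ebitVec, Pi.star_apply]
  by_cases h1 : i.1 = i.2 <;> by_cases h2 : j.1 = j.2 <;> simp [h1, h2]
  rw [← mul_inv, h]

/-- Each of the four entries in the overlap deviates from 1/2 by at most the trace norm, which is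
twice the trace distance. The constant is crude, but only the limit matters. -/
theorem one_sub_le_ebitFidelity (S : Matrix (Fin 2 × Fin 2) (Fin 2 × Fin 2) ℂ) :
    1 - 4 * traceDist S ebit ≤ ebitFidelity S := by
  have h : ∀ i j, (ebit i j).re - traceNorm (S - ebit) ≤ (S i j).re := fun i j => by
    have h1 := norm_apply_le_traceNorm (S - ebit) i j
    have h2 := (Complex.abs_re_le_norm ((S - ebit) i j)).trans h1
    rw [Matrix.sub_apply, Complex.sub_re] at h2
    linarith [(abs_le.1 h2).1]
  have h1 := h (0, 0) (0, 0)
  have h2 := h (0, 0) (1, 1)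
  have h3 := h (1, 1) (0, 0)
  have h4 := h (1, 1) (1, 1)
  simp only [ebit_apply, and_self, if_true] at h1 h2 h3 h4
  norm_num at h1 h2 h3 h4
  simp only [traceDist, ebitFidelity, Complex.add_re]
  linarith

/-- The squared Frobenius distance to the ebit is purity plus 1 minus twice the overlap, and the
purity of a density matrix is at most 1. -/
theorem traceDist_ebit_sq_le {S : Matrix (Fin 2 × Fin 2) (Fin 2 × Fin 2) ℂ} (hS : IsDensity S) :
    traceDist S ebit ^ 2 ≤ 2 * (1 - ebitFidelity S) := by
  have h1 := traceNorm_sq_le (S - ebit)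
  have h2 := hS.sum_norm_sq_le_one
  have h3 : ∑ i, ∑ j, ‖(S - ebit) i j‖ ^ 2
      = ∑ i, ∑ j, ‖S i j‖ ^ 2 + 1 - 2 * ebitFidelity S := by
    simp only [Matrix.sub_apply, ebit_apply, ebitFidelity, Fintype.sum_prod_type,
      Fin.sum_univ_two, ← Complex.normSq_eq_norm_sq, Complex.normSq_apply]
    simp
    ring
  have h4 : (Fintype.card (Fin 2 × Fin 2) : ℝ) = 4 := by simp
  rw [h3, h4] at h1
  rw [traceDist]
  nlinarith

/-- Operators with positive partial transpose have overlap at most `1/2` with `Φ`. -/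
theorem two_mul_ebitFidelity_le_trace {S T : Matrix (Fin 2 × Fin 2) (Fin 2 × Fin 2) ℂ}
    (hT : T.PosSemidef) (h : ∀ i j k l, T (i, j) (k, l) = S (k, j) (i, l)) :
    2 * ebitFidelity S ≤ S.trace.re := by
  -- Partial transposition moves the coherences between 00 and 11 to positions between 01 and 10.
  -- Testing `T` on the singlet vector therefore bounds them by the diagonal entries at 01 and 10.
  have h1 := hT.dotProduct_mulVec_nonneg
    (fun p => if p = (0, 1) then 1 else if p = (1, 0) then -1 else 0)
  have h2 := (Complex.le_def.1 h1).1
  simp [dotProduct, mulVec, Fintype.sum_prod_type, Fin.sum_univ_two, h] at h2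
  simp only [ebitFidelity, Complex.add_re, Matrix.trace, Matrix.diag_apply,
    Fintype.sum_prod_type, Fin.sum_univ_two]
  linarith

end Fidelity

/-! ### Tensor powers of a bipartite state -/

section Copies

variable {A B : Type}

theorem copies_swap (n : ℕ) (ρ : Matrix (A × B) (A × B) ℂ) :
    copies n (ρ.submatrix Prod.swap Prod.swap) =
      (copies n ρ).submatrix Prod.swap Prod.swap := rfl

variable [Fintype A] [Fintype B]

theorem sum_prod_arrow {n : ℕ} (g : Fin n → A × B → ℂ) :
    ∑ p : (Fin n → A) × (Fin n → B), ∏ i, g i (p.1 i, p.2 i) = ∏ i, ∑ q, g i q := by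
  classical
  rw [Fintype.prod_sum]
  exact (Fintype.sum_equiv (Equiv.arrowProdEquivProdArrow (Fin n) (fun _ => A) (fun _ => B)) _ _
    fun x => rfl).symm

theorem copies_mul (n : ℕ) (P Q : Matrix (A × B) (A × B) ℂ) :
    copies n (P * Q) = copies n P * copies n Q := by
  ext x y
  simp only [copies, Matrix.mul_apply, ← Finset.prod_mul_distrib]
  exact (sum_prod_arrow fun i q => P (x.1 i, x.2 i) q * Q q (y.1 i, y.2 i)).symm

theorem copies_isDensity (n : ℕ) {ρ : Matrix (A × B) (A × B) ℂ} (hρ : IsDensity ρ) :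
    IsDensity (copies n ρ) := by
  constructor
  · obtain ⟨R, rfl⟩ := hρ.1.exists_conjTranspose_mul_self
    have : copies n Rᴴ = (copies n R)ᴴ := by
      ext x y
      simp [copies]
    rw [copies_mul, this]
    exact posSemidef_conjTranspose_mul_self _
  · have h : (copies n ρ).trace = ∏ _i : Fin n, ρ.trace :=
      sum_prod_arrow fun _ q => ρ q q
    rw [h, hρ.2, Finset.prod_const_one]

end Copies

/-! ### Row-wise products of filters and Hadamard products -/

section FaceSplit

variable {A B T U : Type} {n m : ℕ}

/-- The row-wise tensor product of two operators with the same output system. -/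
def faceSplit (K : Matrix T (Fin n → A) ℂ) (L : Matrix T (Fin m → A) ℂ) :
    Matrix T (Fin (n + m) → A) ℂ :=
  fun t w => K t (fun i => w (Fin.castAdd m i)) * L t (fun i => w (Fin.natAdd n i))

theorem sum_append [Fintype A] [Fintype B] (f : (Fin n → A) → (Fin n → B) → ℂ)
    (g : (Fin m → A) → (Fin m → B) → ℂ) :
    ∑ p : (Fin (n + m) → A) × (Fin (n + m) → B),
      f (fun i => p.1 (Fin.castAdd m i)) (fun i => p.2 (Fin.castAdd m i)) *
        g (fun i => p.1 (Fin.natAdd n i)) (fun i => p.2 (Fin.natAdd n i)) =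
      (∑ p : (Fin n → A) × (Fin n → B), f p.1 p.2) *
        ∑ p : (Fin m → A) × (Fin m → B), g p.1 p.2 := by
  rw [Fintype.sum_mul_sum, ← Fintype.sum_prod_type']
  refine (Fintype.sum_equiv ((Equiv.prodProdProdComm _ _ _ _).trans
    (Equiv.prodCongr (Fin.appendEquiv n m) (Fin.appendEquiv n m))) _ _ fun p => ?_).symm
  simp [Fin.appendEquiv]

/-- Filtering with row-wise tensor products gives the Hadamard product of the filtered states. -/
theorem localFilter_faceSplit [Fintype A] [Fintype B] (ρ : Matrix (A × B) (A × B) ℂ)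
    (K : Matrix T (Fin n → A) ℂ) (K' : Matrix T (Fin m → A) ℂ)
    (L : Matrix U (Fin n → B) ℂ) (L' : Matrix U (Fin m → B) ℂ) (p q : T × U) :
    localFilter (faceSplit K K') (faceSplit L L') (copies (n + m) ρ) p q =
      localFilter K L (copies n ρ) p q * localFilter K' L' (copies m ρ) p q := by
  obtain ⟨i, j⟩ := p
  obtain ⟨k, l⟩ := q
  rw [localFilter_apply, localFilter_apply, localFilter_apply]
  have h := sum_append (A := A) (B := B) (n := n) (m := m)
    (fun x y => ∑ q : (Fin n → A) × (Fin n → B),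
      K i x * L j y * copies n ρ (x, y) q * (star (K k q.1) * star (L l q.2)))
    (fun x y => ∑ q : (Fin m → A) × (Fin m → B),
      K' i x * L' j y * copies m ρ (x, y) q * (star (K' k q.1) * star (L' l q.2)))
  refine Eq.trans (Finset.sum_congr rfl fun p _ => ?_) h
  have h2 := sum_append (A := A) (B := B) (n := n) (m := m)
    (fun x y => K i (fun i => p.1 (Fin.castAdd m i)) * L j (fun i => p.2 (Fin.castAdd m i)) *
      copies n ρ (fun i => p.1 (Fin.castAdd m i), fun i => p.2 (Fin.castAdd m i)) (x, y) *
        (star (K k x) * star (L l y)))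
    (fun x y => K' i (fun i => p.1 (Fin.natAdd n i)) * L' j (fun i => p.2 (Fin.natAdd n i)) *
      copies m ρ (fun i => p.1 (Fin.natAdd n i), fun i => p.2 (Fin.natAdd n i)) (x, y) *
        (star (K' k x) * star (L' l y)))
  refine Eq.trans (Finset.sum_congr rfl fun q _ => ?_) h2
  simp only [faceSplit, copies, Fin.prod_univ_add, star_mul']
  ring

end FaceSplit

/-! ### A sufficient condition for incoherence -/

section Incoherent

variable {S T : Type}

/-- Every column has at most one nonzero entry. -/
def ColumnDisjoint (K : Matrix T S ℂ) : Prop :=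
  ∀ t t' x, t ≠ t' → K t x = 0 ∨ K t' x = 0

/-- For diagonal `σ`, an off-diagonal entry of the output sums terms containing `K t x` and the
conjugate of `K t' x`, one of which vanishes. -/
theorem ColumnDisjoint.isIncoherentKraus [Fintype S] {K : Matrix T S ℂ} (h : ColumnDisjoint K) :
    IsIncoherentKraus K := by
  intro σ hσ t t' htt'
  rw [Matrix.mul_apply]
  refine Finset.sum_eq_zero fun x _ => ?_
  rw [Matrix.mul_apply, Finset.sum_eq_single x]
  · rcases h t t' x htt' with h | h <;> simp [h]
  · intro y _ hy
    rw [hσ.2 hy, mul_zero]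
  · simp

theorem ColumnDisjoint.smul {K : Matrix T S ℂ} (h : ColumnDisjoint K) (c : ℂ) :
    ColumnDisjoint (c • K) := fun t t' x htt' =>
  (h t t' x htt').imp (fun h => by simp [h]) (fun h => by simp [h])

/-- A zero in one factor kills the product entry. The other factor is arbitrary, which is how an
arbitrary filter becomes incoherent. -/
theorem ColumnDisjoint.faceSplit_left {A : Type} {n m : ℕ} {K : Matrix T (Fin n → A) ℂ}
    (h : ColumnDisjoint K) (L : Matrix T (Fin m → A) ℂ) : ColumnDisjoint (faceSplit K L) :=
  fun t t' _ htt' => (h t t' _ htt').imp (mul_eq_zero_of_left · _) (mul_eq_zero_of_left · _)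

theorem ColumnDisjoint.faceSplit_right {A : Type} {n m : ℕ} {K : Matrix T (Fin m → A) ℂ}
    (h : ColumnDisjoint K) (L : Matrix T (Fin n → A) ℂ) : ColumnDisjoint (faceSplit L K) :=
  fun t t' _ htt' => (h t t' _ htt').imp (mul_eq_zero_of_right _) (mul_eq_zero_of_right _)

theorem ColumnDisjoint.kronecker_one {K : Matrix T S ℂ} (h : ColumnDisjoint K) (R : Type)
    [DecidableEq R] : ColumnDisjoint (K ⊗ₖ (1 : Matrix R R ℂ)) := by
  rintro ⟨t, r⟩ ⟨t', r'⟩ ⟨x, s⟩ hne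
  by_cases hr : r = s
  · by_cases hr' : r' = s
    · have htt' : t ≠ t' := fun e => hne (by rw [e, hr, hr'])
      exact (h t t' x htt').imp (fun h => by simp [h]) (fun h => by simp [h])
    · exact Or.inr (by simp [hr'])
  · exact Or.inl (by simp [hr])

end Incoherent

/-! ### Extracting coherence from many copies -/

section Coherence

open Filter Topology

variable {A B : Type} [Fintype A] [Fintype B]

/-- Polarization over `ℂ`: a matrix whose quadratic form vanishes is zero. It lets Bob project on
one vector without destroying a nonzero off-diagonal block. -/
theorem exists_quadratic_ne_zero {D : Matrix B B ℂ} (hD : D ≠ 0) :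
    ∃ e : B → ℂ, ∑ y, ∑ y', e y * D y y' * star (e y') ≠ 0 := by
  classical
  by_contra! h
  refine hD (Matrix.toEuclideanLin.map_eq_zero_iff.1 ((inner_map_self_eq_zero _).1 fun x => ?_))
  have hx := h fun y => star (x y)
  rw [← star_eq_zero, ← hx, PiLp.inner_apply, star_sum]
  refine Finset.sum_congr rfl fun y _ => ?_
  simp [Matrix.toEuclideanLin, Matrix.mulVec, dotProduct, Finset.mul_sum, mul_assoc, mul_comm,
    mul_left_comm]

/-- The matrix element of `ρ` between the product vectors with conjugate coordinates
`s₁ ⊗ e` and `s₂ ⊗ e`. -/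
def productForm (ρ : Matrix (A × B) (A × B) ℂ) (e : B → ℂ) (s₁ s₂ : A → ℂ) : ℂ :=
  ∑ p, ∑ q, s₁ p.1 * e p.2 * ρ p q * (star (s₂ q.1) * star (e q.2))

/-- Tensor powers turn a strict inequality between two matrix elements into an exponentially growing
ratio; this is the purification mechanism. -/
theorem productForm_copies (ρ : Matrix (A × B) (A × B) ℂ) (e : B → ℂ) (s₁ s₂ : A → ℂ) (m : ℕ) :
    productForm (copies m ρ) (fun w => ∏ i, e (w i)) (fun u => ∏ i, s₁ (u i))
      (fun u => ∏ i, s₂ (u i)) = productForm ρ e s₁ s₂ ^ m := by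
  have h := sum_prod_arrow (A := A) (B := B) (n := m) fun _ p =>
    ∑ q, s₁ p.1 * e p.2 * ρ p q * (star (s₂ q.1) * star (e q.2))
  rw [Finset.prod_const, Finset.card_univ, Fintype.card_fin] at h
  refine Eq.trans (Finset.sum_congr rfl fun p _ => ?_) h
  have h2 := sum_prod_arrow (A := A) (B := B) (n := m) fun i q =>
    s₁ (p.1 i) * e (p.2 i) * ρ (p.1 i, p.2 i) q * (star (s₂ q.1) * star (e q.2))
  refine Eq.trans (Finset.sum_congr rfl fun q _ => ?_) h2
  simp only [copies, star_prod, Finset.prod_mul_distrib]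

theorem productForm_add_left (ρ : Matrix (A × B) (A × B) ℂ) (e : B → ℂ) (s s' t : A → ℂ) (c : ℂ) :
    productForm ρ e (fun x => s x + c * s' x) t =
      productForm ρ e s t + c * productForm ρ e s' t := by
  simp only [productForm, Finset.mul_sum, ← Finset.sum_add_distrib]
  refine Finset.sum_congr rfl fun p _ => Finset.sum_congr rfl fun q _ => ?_
  ring

theorem productForm_add_right (ρ : Matrix (A × B) (A × B) ℂ) (e : B → ℂ) (s t t' : A → ℂ)
    (c : ℂ) :
    productForm ρ e s (fun x => t x + c * t' x) =
      productForm ρ e s t + star c * productForm ρ e s t' := by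
  simp only [productForm, Finset.mul_sum, ← Finset.sum_add_distrib, star_add, star_mul']
  refine Finset.sum_congr rfl fun p _ => Finset.sum_congr rfl fun q _ => ?_
  ring

theorem productForm_single [DecidableEq A] (ρ : Matrix (A × B) (A × B) ℂ) (e : B → ℂ) (a b : A) :
    productForm ρ e (Pi.single a 1) (Pi.single b 1) =
      localFilter (1 : Matrix A A ℂ) (replicateRow Unit e) ρ (a, ()) (b, ()) := by
  rw [localFilter_apply]
  simp only [productForm, Matrix.one_apply, Pi.single_apply, replicateRow_apply, eq_comm]

/-- Two sequences of local filters, incoherent on Alice's side, that turn copies of `ρ` into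
increasingly pure maximally coherent qubits of Alice. -/
theorem exists_coherent_filter {ρ : Matrix (A × B) (A × B) ℂ} (hρ : ρ.PosSemidef) {a b : A}
    (hab : a ≠ b) {y y' : B} (h : ρ (a, y) (b, y') ≠ 0) :
    ∃ (q : ℝ) (C : ∀ m, Matrix (Fin 2) (Fin m → A) ℂ) (G : ∀ m, Matrix (Fin 2) (Fin m → B) ℂ),
      0 < q ∧ (∀ m, ColumnDisjoint (C m)) ∧ ∀ p p', Tendsto
        (fun m => localFilter (C m) (G m) (copies m ρ) p p' / (q : ℂ) ^ m) atTop (𝓝 1) := by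
  classical
  obtain ⟨e, he⟩ := exists_quadratic_ne_zero (D := fun y y' => ρ (a, y) (b, y'))
    (fun h0 => h (congrFun (congrFun h0 y) y'))
  set T := localFilter (1 : Matrix A A ℂ) (replicateRow Unit e) ρ with hTdef
  have hT : T.PosSemidef := localFilter_posSemidef hρ _ _
  obtain ⟨β, hβ⟩ : ∃ β, β = T (a, ()) (b, ()) := ⟨_, rfl⟩
  have hβ0 : β ≠ 0 := by
    rw [hβ, hTdef, localFilter_apply]
    simpa [Matrix.one_apply, Fintype.sum_prod_type, Finset.sum_ite_irrel, mul_assoc] using he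
  have hba : T (b, ()) (a, ()) = star β := by
    rw [hβ, hT.1.apply]
  obtain ⟨α, hα⟩ : ∃ α : ℝ, T (a, ()) (a, ()) = α :=
    ⟨_, (hT.1.coe_re_apply_self (a, ())).symm⟩
  obtain ⟨γ, hγ⟩ : ∃ γ : ℝ, T (b, ()) (b, ()) = γ :=
    ⟨_, (hT.1.coe_re_apply_self (b, ())).symm⟩
  have hα0 : 0 ≤ α := by
    have := hT.diag_nonneg (i := (a, ())); rw [hα] at this; exact_mod_cast this
  have hγ0 : 0 ≤ γ := by
    have := hT.diag_nonneg (i := (b, ())); rw [hγ] at this; exact_mod_cast this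
  have hβn : 0 < ‖β‖ ^ 2 := by positivity
  have hαγ : ‖β‖ ^ 2 ≤ α * γ := by
    have := hT.norm_apply_sq_le (a, ()) (b, ())
    rwa [hα, hγ, ← hβ] at this
  have hαpos : 0 < α := by
    rcases hα0.eq_or_lt with h | h
    · rw [← h] at hαγ; linarith
    · exact h
  have hββ : β * star β = ((‖β‖ ^ 2 : ℝ) : ℂ) := by
    push_cast; exact Complex.mul_conj' β
  set N := ‖β‖ ^ 2
  -- The coefficient `β` aligns phases: in the form at `(s, s)` both cross terms contribute `+N`,
  -- and at `(s', s')` both contribute `-N`. The sign change leaves the pointwise squares equal.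
  set s : A → ℂ := fun x => (Pi.single a 1 : A → ℂ) x + β * (Pi.single b 1 : A → ℂ) x with hs
  set s' : A → ℂ := fun x => (Pi.single a 1 : A → ℂ) x + -β * (Pi.single b 1 : A → ℂ) x with hs'
  have hsq : ∀ x, s' x * s' x = s x * s x := fun x => by
    by_cases hx : x = a
    · subst hx; simp [hs, hs', hab]
    · simp [hs, hs', hx]
  have h1 : productForm ρ e s s = ((α + N * γ + 2 * N : ℝ) : ℂ) := by
    rw [hs, productForm_add_left, productForm_add_right, productForm_add_right]
    simp only [productForm_single, ← hTdef, hα, hγ, hba, ← hβ]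
    push_cast
    linear_combination (γ + 2 : ℂ) * hββ
  have h2 : productForm ρ e s s' = ((α - N * γ : ℝ) : ℂ) := by
    rw [hs, hs', productForm_add_left, productForm_add_right, productForm_add_right]
    simp only [productForm_single, ← hTdef, hα, hγ, hba, ← hβ, star_neg]
    push_cast
    linear_combination (-γ : ℂ) * hββ
  have h3 : productForm ρ e s' s = ((α - N * γ : ℝ) : ℂ) := by
    rw [hs, hs', productForm_add_left, productForm_add_right, productForm_add_right]
    simp only [productForm_single, ← hTdef, hα, hγ, hba, ← hβ]
    push_cast
    linear_combination (-γ : ℂ) * hββ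
  have h4 : productForm ρ e s' s' = ((α + N * γ - 2 * N : ℝ) : ℂ) := by
    rw [hs', productForm_add_left, productForm_add_right, productForm_add_right]
    simp only [productForm_single, ← hTdef, hα, hγ, hba, ← hβ, star_neg]
    push_cast
    linear_combination (γ - 2 : ℂ) * hββ
  have hNγ : 0 ≤ N * γ := by positivity
  have hq : 0 < α + N * γ + 2 * N := by positivity
  set q := α + N * γ + 2 * N with hqdef
  let sg : Fin 2 → ℂ := fun j => if j = 0 then 1 else -1
  -- Alice's rows are the sum and difference of `s^{⊗m}` and `s'^{⊗m}`; their entrywise product is a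
  -- difference of equal squares, hence zero. Bob's two rows coincide, so the output does not depend
  -- on his indices.
  refine ⟨q, fun m j u => (∏ i, s (u i)) + sg j * ∏ i, s' (u i), fun m _ w => ∏ i, e (w i), hq,
    fun m t t' u htt' => ?_, ?_⟩
  · have hprod : (∏ i, s' (u i)) * (∏ i, s' (u i)) = (∏ i, s (u i)) * ∏ i, s (u i) := by
      simp only [← Finset.prod_mul_distrib, hsq]
    rw [← mul_eq_zero]
    have : sg t * sg t' = -1 ∧ sg t + sg t' = 0 := by
      fin_cases t <;> fin_cases t' <;> simp_all [sg]
    linear_combination (-1 : ℂ) * hprod + (∏ i, s' (u i)) * (∏ i, s' (u i)) * this.1 +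
      (∏ i, s (u i)) * (∏ i, s' (u i)) * this.2
  · rintro ⟨i, j⟩ ⟨k, l⟩
    have hval : ∀ m, localFilter
        (fun (j : Fin 2) (u : Fin m → A) => (∏ i, s (u i)) + sg j * ∏ i, s' (u i))
        (fun (_ : Fin 2) (w : Fin m → B) => ∏ i, e (w i)) (copies m ρ) (i, j) (k, l) / (q : ℂ) ^ m
        = 1 + star (sg k) * (((α - N * γ) / q : ℝ) : ℂ) ^ m +
          sg i * (((α - N * γ) / q : ℝ) : ℂ) ^ m +
          sg i * star (sg k) * (((α + N * γ - 2 * N) / q : ℝ) : ℂ) ^ m := fun m => by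
      have : localFilter
        (fun (j : Fin 2) (u : Fin m → A) => (∏ i, s (u i)) + sg j * ∏ i, s' (u i))
        (fun (_ : Fin 2) (w : Fin m → B) => ∏ i, e (w i)) (copies m ρ) (i, j) (k, l) =
          productForm (copies m ρ) (fun w => ∏ i, e (w i))
            (fun u => (∏ i, s (u i)) + sg i * ∏ i, s' (u i))
            (fun u => (∏ i, s (u i)) + sg k * ∏ i, s' (u i)) :=
        localFilter_apply _ _ _ i k j l
      rw [this, productForm_add_left, productForm_add_right, productForm_add_right]
      simp only [productForm_copies, h1, h2, h3, h4]
      have hq0 : (q : ℂ) ≠ 0 := by exact_mod_cast hq.ne'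
      push_cast
      simp only [div_pow]
      field_simp
      ring
    simp only [hval]
    -- The form at `(s, s)` strictly dominates the other three in modulus because `α` and `N` are
    -- positive; after division by `q ^ m` only its contribution 1 survives.
    have hlim : ∀ x : ℝ, |x| < q → Tendsto (fun m : ℕ => ((x / q : ℝ) : ℂ) ^ m) atTop (𝓝 0) :=
      fun x hx => tendsto_pow_atTop_nhds_zero_of_norm_lt_one (by
        rw [Complex.norm_real, Real.norm_eq_abs, abs_div, abs_of_pos hq, div_lt_one hq]
        exact hx)
    have l1 := hlim (α - N * γ) (by rw [abs_lt]; constructor <;> linarith)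
    have l2 := hlim (α + N * γ - 2 * N) (by rw [abs_lt]; constructor <;> linarith)
    simpa using (((tendsto_const_nhds (x := (1 : ℂ))).add (l1.const_mul (star (sg k)))).add
      (l1.const_mul (sg i))).add (l2.const_mul (sg i * star (sg k)))

end Coherence

/-! ### Good measurement records and their incoherent imitation -/

section Branches

variable {A B : Type} [Fintype A] [Fintype B]

theorem trace_re_nonneg {S : Type} [Fintype S] {M : Matrix S S ℂ} (hM : M.PosSemidef) :
    0 ≤ M.trace.re := (Complex.le_def.1 hM.trace_nonneg).1

theorem ofReal_trace_re {S : Type} [Fintype S] {M : Matrix S S ℂ} (hM : M.PosSemidef) :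
    ((M.trace.re : ℝ) : ℂ) = M.trace :=
  Complex.ext (Complex.ofReal_re _) (Complex.le_def.1 hM.trace_nonneg).2

/-- States that are classical on Alice's side cannot be filtered close to the ebit. -/
theorem two_mul_ebitFidelity_localFilter_le {ρ : Matrix (A × B) (A × B) ℂ} (hρ : IsDensity ρ)
    (h : ∀ a b y y', a ≠ b → ρ (a, y) (b, y') = 0) {n : ℕ}
    (M : Matrix (Fin 2) (Fin n → A) ℂ) (N : Matrix (Fin 2) (Fin n → B) ℂ) :
    2 * ebitFidelity (localFilter M N (copies n ρ)) ≤
      (localFilter M N (copies n ρ)).trace.re := by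
  refine two_mul_ebitFidelity_le_trace
    (localFilter_posSemidef (copies_isDensity n hρ).1 (M.map star) N) fun i j k l => ?_
  rw [localFilter_apply, localFilter_apply]
  refine Finset.sum_congr rfl fun p _ => Finset.sum_congr rfl fun q _ => ?_
  classical
  -- Only terms with equal Alice indices survive. On these, transposing Alice's output amounts to
  -- conjugating `M`, so the partial transpose is itself a filtered state.
  by_cases hpq : p.1 = q.1
  · rw [hpq]
    simp only [Matrix.map_apply, star_star]
    ring
  · obtain ⟨t, ht⟩ := Function.ne_iff.1 hpq
    have h0 : copies n ρ p q = 0 := Finset.prod_eq_zero (Finset.mem_univ t) (h _ _ _ _ ht)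
    simp [h0]

theorem isDensity_swap {ρ : Matrix (A × B) (A × B) ℂ} (hρ : IsDensity ρ) :
    IsDensity (ρ.submatrix Prod.swap Prod.swap) := by
  refine ⟨hρ.1.submatrix _, Eq.trans ?_ hρ.2⟩
  exact Fintype.sum_equiv (Equiv.prodComm B A) _ _ fun p => rfl

variable [DecidableEq A] [DecidableEq B]

/-- Some measurement record of a good distillation protocol is itself good. -/
theorem LOCCDistillable.exists_branch {ρ : Matrix (A × B) (A × B) ℂ} (hρ : IsDensity ρ)
    (h : LOCCDistillable ρ) {δ : ℝ} (hδ : 0 < δ) :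
    ∃ (n : ℕ) (M : Matrix (Fin 2) (Fin n → A) ℂ) (N : Matrix (Fin 2) (Fin n → B) ℂ),
      0 < (localFilter M N (copies n ρ)).trace.re ∧
        (1 - δ) * (localFilter M N (copies n ρ)).trace.re <
          ebitFidelity (localFilter M N (copies n ρ)) := by
  -- Accuracy `δ / 8` gives overlap at least `1 - δ / 2`. The slack makes the averaged inequality
  -- strict, which also excludes a record of trace zero.
  obtain ⟨n, L, hL, hd⟩ := h (δ / 8) (by positivity)
  have hσ := copies_isDensity n hρ
  have hf := one_sub_le_ebitFidelity (L (copies n ρ))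
  have ht := congrArg Complex.re (hL.isDensity hσ).2
  obtain ⟨κ, _, M, N, hLk, -⟩ := hL.exists_kraus
  rw [hLk, Matrix.trace_sum, Complex.re_sum, Complex.one_re] at ht
  have hlt : ∑ r, (1 - δ) * (localFilter (M r) (N r) (copies n ρ)).trace.re <
      ∑ r, ebitFidelity (localFilter (M r) (N r) (copies n ρ)) := by
    rw [← Finset.mul_sum, ht, ← ebitFidelity_sum, ← hLk]
    linarith
  obtain ⟨r, -, hr⟩ := Finset.exists_lt_of_sum_lt hlt
  refine ⟨n, M r, N r, ?_, hr⟩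
  have hp := localFilter_posSemidef hσ.1 (M r) (N r)
  refine (trace_re_nonneg hp).lt_of_ne fun h0 => ?_
  have hz : localFilter (M r) (N r) (copies n ρ) = 0 := by
    rw [← hp.trace_eq_zero_iff, ← ofReal_trace_re hp, ← h0, Complex.ofReal_zero]
  rw [hz] at hr
  simp [ebitFidelity] at hr

/-- Otherwise the bound 1/2 for states classical on Alice's side contradicts a record with relative
overlap above 1/2. -/
theorem LOCCDistillable.exists_ne_zero_left {ρ : Matrix (A × B) (A × B) ℂ} (hρ : IsDensity ρ)
    (h : LOCCDistillable ρ) : ∃ a b y y', a ≠ b ∧ ρ (a, y) (b, y') ≠ 0 := by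
  by_contra! hc
  obtain ⟨n, M, N, h0, h1⟩ := h.exists_branch hρ (δ := 1 / 2) (by norm_num)
  linarith [two_mul_ebitFidelity_localFilter_le hρ hc M N]

theorem LOCCDistillable.exists_ne_zero_right {ρ : Matrix (A × B) (A × B) ℂ} (hρ : IsDensity ρ)
    (h : LOCCDistillable ρ) : ∃ a b y y', a ≠ b ∧ ρ (y, a) (y', b) ≠ 0 := by
  by_contra! hc
  obtain ⟨n, M, N, h0, h1⟩ := h.exists_branch hρ (δ := 1 / 2) (by norm_num)
  have h2 := two_mul_ebitFidelity_localFilter_le (isDensity_swap hρ) hc N M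
  rw [copies_swap, localFilter_swap] at h2
  have h3 : ((localFilter M N (copies n ρ)).submatrix Prod.swap Prod.swap).trace =
      (localFilter M N (copies n ρ)).trace :=
    Fintype.sum_equiv (Equiv.prodComm _ _) _ _ fun p => rfl
  rw [h3] at h2
  change 2 * ebitFidelity (localFilter M N (copies n ρ)) ≤ _ at h2
  linarith

open Filter Topology in
/-- Coherence extracted from additional copies makes any good filter incoherent. -/
theorem LOCCDistillable.exists_incoherent_branch {ρ : Matrix (A × B) (A × B) ℂ}
    (hρ : IsDensity ρ) (h : LOCCDistillable ρ) {δ : ℝ} (hδ : 0 < δ) :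
    ∃ (n : ℕ) (K : Matrix (Fin 2) (Fin n → A) ℂ) (L : Matrix (Fin 2) (Fin n → B) ℂ),
      ColumnDisjoint K ∧ ColumnDisjoint L ∧
      0 < (localFilter K L (copies n ρ)).trace.re ∧
        (1 - δ) * (localFilter K L (copies n ρ)).trace.re <
          ebitFidelity (localFilter K L (copies n ρ)) := by
  obtain ⟨n, M, N, h0, h1⟩ := h.exists_branch hρ hδ
  obtain ⟨a, b, y, y', hab, hne⟩ := h.exists_ne_zero_left hρ
  obtain ⟨q, C, G, hq, hC, hlim⟩ := exists_coherent_filter hρ.1 hab hne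
  obtain ⟨a', b', z, z', hab', hne'⟩ := h.exists_ne_zero_right hρ
  obtain ⟨q', C', G', hq', hC', hlim'⟩ := exists_coherent_filter
    (ρ := ρ.submatrix Prod.swap Prod.swap) (isDensity_swap hρ).1 hab' (y := z) (y' := z') hne'
  -- Disjoint blocks of `n`, `m` and `m` copies feed the original filter, the coherence filter for
  -- Alice and the one for Bob. `C m` makes Alice's operator column-disjoint and `C' m` makes Bob's
  -- so.
  let W : ∀ m, Matrix (Fin 2 × Fin 2) (Fin 2 × Fin 2) ℂ := fun m =>
    localFilter (faceSplit (faceSplit M (C m)) (G' m)) (faceSplit (faceSplit N (G m)) (C' m))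
      (copies (n + m + m) ρ)
  have hW : Tendsto (fun m => (((q ^ m * q' ^ m)⁻¹ : ℝ) : ℂ) • W m) atTop
      (𝓝 (localFilter M N (copies n ρ))) := by
    refine tendsto_pi_nhds.2 fun p => tendsto_pi_nhds.2 fun p' => ?_
    have l1 := hlim p p'
    have l2 := hlim' p.swap p'.swap
    have l3 := (l1.const_mul (localFilter M N (copies n ρ) p p')).mul l2
    rw [mul_one, mul_one] at l3
    refine l3.congr fun m => ?_
    simp only [W, Matrix.smul_apply, localFilter_faceSplit, copies_swap, localFilter_swap,
      Matrix.submatrix_apply, Prod.swap_swap, smul_eq_mul]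
    push_cast
    ring
  have ct : Continuous fun S : Matrix (Fin 2 × Fin 2) (Fin 2 × Fin 2) ℂ => S.trace.re :=
    Complex.continuous_re.comp continuous_id.matrix_trace
  have cf : Continuous ebitFidelity := by
    unfold ebitFidelity
    fun_prop
  -- Both inequalities are strict, hence persist for large `m`; both are homogeneous, so the
  -- positive rescaling factor can then be dropped.
  have e1 := ((ct.tendsto _).comp hW).eventually_const_lt h0
  have e2 := (((ct.tendsto _).comp hW).const_mul (1 - δ)).eventually_lt
    ((cf.tendsto _).comp hW) h1
  obtain ⟨m, hm1, hm2⟩ := (e1.and e2).exists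
  have hc : 0 < (q ^ m * q' ^ m)⁻¹ := by positivity
  simp only [Function.comp_apply, Matrix.trace_smul, smul_eq_mul, Complex.re_ofReal_mul,
    ebitFidelity_smul] at hm1 hm2
  refine ⟨n + m + m, _, _, ((hC m).faceSplit_right M).faceSplit_left (G' m),
    (hC' m).faceSplit_right (faceSplit N (G m)), pos_of_mul_pos_right hm1 hc.le,
    lt_of_mul_lt_mul_left ?_ hc.le⟩
  linarith

end Branches

/-! ### Completing an operator to an incoherent measurement -/

section Completion

/-- A multiple of any incoherent operator to a qubit is part of an incoherent measurement. -/
theorem ColumnDisjoint.exists_measurement {X : Type} [Fintype X] [DecidableEq X]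
    {K : Matrix (Fin 2) X ℂ} (hK : ColumnDisjoint K) :
    ∃ (c : ℝ) (F : Option X → Matrix (Fin 2) X ℂ), 0 < c ∧ F none = (c : ℂ) • K ∧
      ∑ i, (F i)ᴴ * F i = 1 ∧ ∀ i, ColumnDisjoint (F i) := by
  obtain ⟨r, hr, hrK⟩ : ∃ r : ℝ, 0 ≤ r ∧ ((r : ℂ) • (1 : Matrix X X ℂ) - Kᴴ * K).PosSemidef := by
    open scoped MatrixOrder Matrix.Norms.L2Operator in
    refine ⟨‖Kᴴ * K‖, norm_nonneg _, ?_⟩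
    have h := (show IsSelfAdjoint (Kᴴ * K) from
      isHermitian_conjTranspose_mul_self K).le_algebraMap_norm_self
    rw [Matrix.le_iff, Algebra.algebraMap_eq_smul_one] at h
    exact h
  have hpos : (0 : ℝ) < r + 1 := by positivity
  obtain ⟨c, hc, hcc⟩ : ∃ c : ℝ, 0 < c ∧ c * c = (r + 1)⁻¹ :=
    ⟨Real.sqrt (r + 1)⁻¹, Real.sqrt_pos.2 (inv_pos.2 hpos), Real.mul_self_sqrt (by positivity)⟩
  have hcc' : (c : ℂ) * c * (r + 1) = 1 := by
    have : c * c * (r + 1) = 1 := by rw [hcc, inv_mul_cancel₀ hpos.ne']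
    exact_mod_cast this
  have hP : (1 - ((c : ℂ) • K)ᴴ * ((c : ℂ) • K)).PosSemidef := by
    have h1 := (hrK.add PosSemidef.one).smul (a := ((c * c : ℝ) : ℂ))
      (by exact_mod_cast (mul_pos hc hc).le)
    convert h1 using 1
    simp only [conjTranspose_smul, Matrix.smul_mul, Matrix.mul_smul, smul_smul, Complex.star_def,
      Complex.conj_ofReal]
    have h2 : ((c * c : ℝ) : ℂ) • ((r : ℂ) • (1 : Matrix X X ℂ) - Kᴴ * K + 1) =
        ((c : ℂ) * c * (r + 1)) • (1 : Matrix X X ℂ) - ((c : ℂ) * c) • (Kᴴ * K) := by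
      push_cast
      module
    rw [h2, hcc', one_smul]
  obtain ⟨R, hR⟩ := hP.exists_conjTranspose_mul_self
  -- The complement `1 - c² Kᴴ K = Rᴴ R` is resolved row by row: each row of `R` becomes an operator
  -- with output fixed at 0, which is trivially column-disjoint.
  refine ⟨c, fun i => i.elim ((c : ℂ) • K) fun x => Matrix.of fun t u => if t = 0 then R x u else 0,
    hc, rfl, ?_, ?_⟩
  · rw [Fintype.sum_option]
    have : ∑ x, (Matrix.of fun (t : Fin 2) u => if t = 0 then R x u else 0)ᴴ *
        (Matrix.of fun (t : Fin 2) u => if t = 0 then R x u else 0) = Rᴴ * R := by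
      ext u v
      simp [Matrix.sum_apply, Matrix.mul_apply]
    simp only [Option.elim]
    rw [this, ← hR]
    abel
  · rintro (_ | x)
    · exact hK.smul _
    · intro t t' u htt'
      by_cases ht : t = 0
      · have : t' ≠ 0 := fun h => htt' (ht.trans h.symm)
        exact Or.inr (by simp [this])
      · exact Or.inl (by simp [ht])

end Completion

/-! ### Measuring and discarding subsystems incoherently -/

section Discard

/-- The operator that reads off the coordinates selected by `f`. -/
def selector {X T : Type} [DecidableEq X] (f : T → X) : Matrix T X ℂ :=
  (1 : Matrix X X ℂ).submatrix f id

theorem selector_columnDisjoint {X T : Type} [DecidableEq X] {f : T → X}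
    (hf : Function.Injective f) : ColumnDisjoint (selector f) := by
  intro t t' x htt'
  by_cases h : f t = x
  · exact Or.inr (Matrix.one_apply_ne fun h' => htt' (hf (h.trans h'.symm)))
  · exact Or.inl (Matrix.one_apply_ne h)

theorem localFilter_selector {X Y T U : Type} [Fintype X] [DecidableEq X] [Fintype Y]
    [DecidableEq Y] (f : T → X) (g : U → Y) (σ : Matrix (X × Y) (X × Y) ℂ) :
    localFilter (selector f) (selector g) σ = σ.submatrix (Prod.map f g) (Prod.map f g) := by
  have h : selector f ⊗ₖ selector g =
      (1 : Matrix (X × Y) (X × Y) ℂ).submatrix (Prod.map f g) (Equiv.refl _) := by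
    rw [← one_kronecker_one]
    rfl
  rw [localFilter, h, conjTranspose_submatrix, conjTranspose_one, Matrix.mul_assoc,
    ← submatrix_id_id (σ * _), ← submatrix_id_id σ]
  ext p q
  simp [Matrix.mul_apply, Matrix.one_apply]

theorem sum_selector {X T ι : Type} [Fintype X] [DecidableEq X] [Fintype T] [Fintype ι]
    (e : ι × T ≃ X) :
    ∑ i, (selector fun t => e (i, t))ᴴ * (selector fun t => e (i, t)) = 1 := by
  ext u v
  simp only [Matrix.sum_apply, Matrix.mul_apply, conjTranspose_apply, ← Fintype.sum_prod_type']
  refine (Fintype.sum_equiv e _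
    (fun w => star ((1 : Matrix X X ℂ) w u) * (1 : Matrix X X ℂ) w v) fun p => rfl).trans ?_
  simp [Matrix.one_apply, eq_comm]

variable {A' B' X Y T U ι κ : Type} [Fintype A'] [DecidableEq A'] [Fintype B'] [DecidableEq B']
  [Fintype X] [DecidableEq X] [Fintype Y] [DecidableEq Y] [Fintype T] [DecidableEq T]
  [Fintype U] [DecidableEq U] [Fintype ι] [Fintype κ]

/-- Both parties measure and discard a subsystem in the incoherent basis, then go on with `P`. -/
theorem IsProtocol.discard (e : ι × T ≃ X) (f : κ × U ≃ Y)
    {P : Matrix (T × U) (T × U) ℂ → Matrix (A' × B') (A' × B') ℂ}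
    (hP : IsProtocol incoherentKraus T U P) :
    IsProtocol incoherentKraus X Y (fun σ => ∑ i, ∑ j, P (σ.submatrix
      (fun p => (e (i, p.1), f (j, p.2))) (fun p => (e (i, p.1), f (j, p.2))))) := by
  have h := IsProtocol.measure (𝒦 := incoherentKraus) (A' := A') (B' := B')
    (fun i => selector fun t => e (i, t)) (sum_selector e)
    (fun i => (selector_columnDisjoint fun t t' h => by simpa using h).isIncoherentKraus)
    (fun j => selector fun t => f (j, t)) (sum_selector f)
    (fun j => (selector_columnDisjoint fun t t' h => by simpa using h).isIncoherentKraus)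
    (fun _ _ => hP)
  simp only [localFilter_selector] at h
  exact h

end Discard

/-! ### Repeating until success -/

section Repetition

/-- The joint state of two bipartite systems, grouped by party. -/
def jointState {X Y X' Y' : Type} (σ : Matrix (X × Y) (X × Y) ℂ)
    (τ : Matrix (X' × Y') (X' × Y') ℂ) :
    Matrix ((X × X') × (Y × Y')) ((X × X') × (Y × Y')) ℂ :=
  (σ ⊗ₖ τ).submatrix (Equiv.prodProdProdComm X X' Y Y') (Equiv.prodProdProdComm X X' Y Y')

theorem localFilter_jointState {X Y X' Y' T U : Type} [Fintype X] [Fintype Y] [Fintype X']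
    [DecidableEq X'] [Fintype Y'] [DecidableEq Y'] [Fintype T] [Fintype U]
    (K : Matrix T X ℂ) (L : Matrix U Y ℂ)
    (σ : Matrix (X × Y) (X × Y) ℂ) (τ : Matrix (X' × Y') (X' × Y') ℂ) :
    localFilter (K ⊗ₖ (1 : Matrix X' X' ℂ)) (L ⊗ₖ (1 : Matrix Y' Y' ℂ)) (jointState σ τ) =
      jointState (localFilter K L σ) τ := by
  have h : (K ⊗ₖ (1 : Matrix X' X' ℂ)) ⊗ₖ (L ⊗ₖ (1 : Matrix Y' Y' ℂ)) =
      ((K ⊗ₖ L) ⊗ₖ (1 : Matrix (X' × Y') (X' × Y') ℂ)).submatrix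
        (Equiv.prodProdProdComm T X' U Y') (Equiv.prodProdProdComm X X' Y Y') := by
    rw [← one_kronecker_one]
    ext ⟨⟨a, b⟩, c, d⟩ ⟨⟨a', b'⟩, c', d'⟩
    simp only [kroneckerMap_apply, submatrix_apply, Equiv.prodProdProdComm_apply]
    ring
  rw [localFilter, h, jointState, jointState, conjTranspose_submatrix, submatrix_mul_equiv,
    submatrix_mul_equiv, conjTranspose_kronecker, ← mul_kronecker_mul, ← mul_kronecker_mul,
    conjTranspose_one, Matrix.one_mul, Matrix.mul_one, localFilter]

theorem copies_add_submatrix {A B : Type} (n m : ℕ) (ρ : Matrix (A × B) (A × B) ℂ) :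
    (copies (n + m) ρ).submatrix
      (fun p : ((Fin n → A) × (Fin m → A)) × ((Fin n → B) × (Fin m → B)) =>
        (Fin.appendEquiv n m p.1, Fin.appendEquiv n m p.2))
      (fun p => (Fin.appendEquiv n m p.1, Fin.appendEquiv n m p.2)) =
      jointState (copies n ρ) (copies m ρ) := by
  ext ⟨⟨a, b⟩, c, d⟩ ⟨⟨a', b'⟩, c', d'⟩
  simp [jointState, copies, Fin.prod_univ_add, Fin.appendEquiv]

theorem IsProtocol.exists_keep_first (T U X Y : Type) [Fintype T] [DecidableEq T] [Fintype U]
    [DecidableEq U] [Fintype X] [DecidableEq X] [Fintype Y] [DecidableEq Y] :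
    ∃ P : Matrix ((T × X) × (U × Y)) ((T × X) × (U × Y)) ℂ → Matrix (T × U) (T × U) ℂ,
      IsProtocol incoherentKraus (T × X) (U × Y) P ∧
        ∀ R τ, P (jointState R τ) = τ.trace • R := by
  -- The swap puts the second factors in the register that `discard` measures.
  refine ⟨_, IsProtocol.discard (Equiv.prodComm X T) (Equiv.prodComm Y U) .done, fun R τ => ?_⟩
  ext p q
  simp [Matrix.sum_apply, jointState, ← Finset.mul_sum, Matrix.trace, Fintype.sum_prod_type,
    mul_comm]

theorem IsProtocol.exists_keep_second {A' B' X Y : Type} [Fintype A'] [DecidableEq A']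
    [Fintype B'] [DecidableEq B'] [Fintype X] [DecidableEq X] [Fintype Y] [DecidableEq Y]
    {P : Matrix (X × Y) (X × Y) ℂ → Matrix (A' × B') (A' × B') ℂ}
    (hP : IsProtocol incoherentKraus X Y P) (T U : Type) [Fintype T] [DecidableEq T] [Fintype U]
    [DecidableEq U] :
    ∃ Q : Matrix ((T × X) × (U × Y)) ((T × X) × (U × Y)) ℂ → Matrix (A' × B') (A' × B') ℂ,
      IsProtocol incoherentKraus (T × X) (U × Y) Q ∧
        ∀ R τ, Q (jointState R τ) = R.trace • P τ := by
  refine ⟨_, IsProtocol.discard (Equiv.refl (T × X)) (Equiv.refl (U × Y)) hP, fun R τ => ?_⟩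
  have h : ∀ i j, (jointState R τ).submatrix
      (fun p => (Equiv.refl (T × X) (i, p.1), Equiv.refl (U × Y) (j, p.2)))
      (fun p => (Equiv.refl (T × X) (i, p.1), Equiv.refl (U × Y) (j, p.2))) =
      R (i, j) (i, j) • τ := fun i j => by
    ext p q
    simp [jointState]
  simp only [h, hP.map_smul, ← Finset.sum_smul, ← Fintype.sum_prod_type']
  rfl

variable {A B : Type} [Fintype A] [DecidableEq A] [Fintype B] [DecidableEq B]

/-- Attempt a filter on the first `n` copies; on failure run `P` on the remaining ones. -/
theorem IsProtocol.exists_attempt {ρ : Matrix (A × B) (A × B) ℂ} (hρ : IsDensity ρ) {n m : ℕ}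
    {I J : Type} [Fintype I] [Fintype J] [DecidableEq I] [DecidableEq J]
    (F : I → Matrix (Fin 2) (Fin n → A) ℂ) (hF : ∑ i, (F i)ᴴ * F i = 1)
    (mF : ∀ i, ColumnDisjoint (F i))
    (G : J → Matrix (Fin 2) (Fin n → B) ℂ) (hG : ∑ j, (G j)ᴴ * G j = 1)
    (mG : ∀ j, ColumnDisjoint (G j)) (i₀ : I) (j₀ : J)
    {P : Matrix ((Fin m → A) × (Fin m → B)) ((Fin m → A) × (Fin m → B)) ℂ →
      Matrix (Fin 2 × Fin 2) (Fin 2 × Fin 2) ℂ}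
    (hP : IsProtocol incoherentKraus (Fin m → A) (Fin m → B) P) :
    (localFilter (F i₀) (G j₀) (copies n ρ)).trace.re ≤ 1 ∧
    ∃ Q : Matrix ((Fin (n + m) → A) × (Fin (n + m) → B))
        ((Fin (n + m) → A) × (Fin (n + m) → B)) ℂ → Matrix (Fin 2 × Fin 2) (Fin 2 × Fin 2) ℂ,
      IsProtocol incoherentKraus (Fin (n + m) → A) (Fin (n + m) → B) Q ∧
      Q (copies (n + m) ρ) = localFilter (F i₀) (G j₀) (copies n ρ) +
        ((1 - (localFilter (F i₀) (G j₀) (copies n ρ)).trace.re : ℝ) : ℂ) •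
          P (copies m ρ) := by
  have hσ := copies_isDensity n hρ
  have hτ := copies_isDensity m hρ
  set S : I × J → Matrix (Fin 2 × Fin 2) (Fin 2 × Fin 2) ℂ := fun r =>
    localFilter (F r.1) (G r.2) (copies n ρ) with hS
  have hSp : ∀ r, (S r).PosSemidef := fun r => localFilter_posSemidef hσ.1 _ _
  -- Outcome probabilities sum to 1 because stopping right after the measurement is itself a
  -- protocol.
  have htr : ∑ r, (S r).trace = 1 := by
    have := ((IsProtocol.measure (𝒦 := allKraus) F hF (fun _ => trivial) G hG
      (fun _ => trivial) fun _ _ => .done).isDensity hσ).2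
    simp only [← Fintype.sum_prod_type', Matrix.trace_sum] at this
    exact this
  have hsplit := Finset.add_sum_erase Finset.univ (fun r => (S r).trace)
    (Finset.mem_univ (i₀, j₀))
  simp only [htr] at hsplit
  have hrest : ∑ r ∈ Finset.univ.erase (i₀, j₀), (S r).trace =
      ((1 - (S (i₀, j₀)).trace.re : ℝ) : ℂ) := by
    rw [Complex.ofReal_sub, ofReal_trace_re (hSp _), Complex.ofReal_one]
    linear_combination hsplit
  refine ⟨?_, ?_⟩
  · have h := congrArg Complex.re hrest
    rw [Complex.re_sum, Complex.ofReal_re] at h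
    have : 0 ≤ ∑ r ∈ Finset.univ.erase (i₀, j₀), (S r).trace.re :=
      Finset.sum_nonneg fun r _ => trace_re_nonneg (hSp r)
    change (S (i₀, j₀)).trace.re ≤ 1
    linarith
  · obtain ⟨Pg, hgood, vgood⟩ :=
      IsProtocol.exists_keep_first (Fin 2) (Fin 2) (Fin m → A) (Fin m → B)
    obtain ⟨Pb, hbad, vbad⟩ := hP.exists_keep_second (Fin 2) (Fin 2)
    have hmeas := IsProtocol.measure (𝒦 := incoherentKraus)
      (fun i => F i ⊗ₖ (1 : Matrix (Fin m → A) (Fin m → A) ℂ)) (sum_kronecker_one hF)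
      (fun i => ((mF i).kronecker_one _).isIncoherentKraus)
      (fun j => G j ⊗ₖ (1 : Matrix (Fin m → B) (Fin m → B) ℂ)) (sum_kronecker_one hG)
      (fun j => ((mG j).kronecker_one _).isIncoherentKraus)
      (L := fun i j => if (i, j) = (i₀, j₀) then Pg else Pb)
      (fun i j => by split_ifs <;> assumption)
    -- Here `discard` has a one-point measured register: nothing is lost, and the copies are merely
    -- regrouped as `n` and `m`.
    refine ⟨_, IsProtocol.discard
      ((Equiv.punitProd _).trans (Fin.appendEquiv n m))
      ((Equiv.punitProd _).trans (Fin.appendEquiv n m)) hmeas, ?_⟩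
    simp only [Finset.univ_unique, Finset.sum_singleton, Equiv.trans_apply,
      Equiv.punitProd_apply, copies_add_submatrix, localFilter_jointState]
    rw [← Fintype.sum_prod_type', ← Finset.add_sum_erase _ _ (Finset.mem_univ (i₀, j₀))]
    rw [if_pos rfl, vgood, hτ.2, one_smul]
    congr 1
    rw [← hrest, Finset.sum_smul]
    refine Finset.sum_congr rfl fun r hr => ?_
    rw [if_neg (Finset.ne_of_mem_erase hr), vbad]

/-- Repeating a filter with success probability `p` succeeds up to probability `(1 - p) ^ N`. -/
theorem exists_repeated_protocol {ρ : Matrix (A × B) (A × B) ℂ} (hρ : IsDensity ρ) {n : ℕ}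
    {I J : Type} [Fintype I] [Fintype J] [DecidableEq I] [DecidableEq J]
    (F : I → Matrix (Fin 2) (Fin n → A) ℂ) (hF : ∑ i, (F i)ᴴ * F i = 1)
    (mF : ∀ i, ColumnDisjoint (F i))
    (G : J → Matrix (Fin 2) (Fin n → B) ℂ) (hG : ∑ j, (G j)ᴴ * G j = 1)
    (mG : ∀ j, ColumnDisjoint (G j)) (i₀ : I) (j₀ : J) {p δ : ℝ}
    (hp : (localFilter (F i₀) (G j₀) (copies n ρ)).trace.re = p)
    (hδ : (1 - δ) * p ≤ ebitFidelity (localFilter (F i₀) (G j₀) (copies n ρ))) (N : ℕ) :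
    p ≤ 1 ∧ ∃ (m : ℕ) (P : Matrix ((Fin m → A) × (Fin m → B)) ((Fin m → A) × (Fin m → B)) ℂ →
        Matrix (Fin 2 × Fin 2) (Fin 2 × Fin 2) ℂ),
      IsProtocol incoherentKraus (Fin m → A) (Fin m → B) P ∧
      (1 - δ) * (1 - (1 - p) ^ N) ≤ ebitFidelity (P (copies m ρ)) := by
  induction N with
  | zero =>
    -- With no attempts the claimed bound is 0, so preparing the product state 00 from zero copies
    -- suffices.
    let H : ∀ (C : Type), Unit → Matrix (Fin 2) (Fin 0 → C) ℂ := fun _ _ =>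
      Matrix.of fun t _ => if t = 0 then 1 else 0
    have hH : ∀ (C : Type), ∑ i, (H C i)ᴴ * H C i = 1 := fun C => by
      ext u v
      rw [Subsingleton.elim u v]
      simp [H, Matrix.mul_apply]
    have mH : ∀ C i, ColumnDisjoint (H C i) := fun C i t t' x htt' => by
      fin_cases t <;> fin_cases t' <;> simp_all [H]
    have hP := IsProtocol.measure (𝒦 := incoherentKraus) (H A) (hH A)
      (fun i => (mH A i).isIncoherentKraus) (H B) (hH B)
      (fun i => (mH B i).isIncoherentKraus) fun _ _ => .done
    refine ⟨hp ▸ (IsProtocol.exists_attempt hρ F hF mF G hG mG i₀ j₀ hP).1, 0, _, hP, ?_⟩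
    simpa using ebitFidelity_nonneg (hP.isDensity (copies_isDensity 0 hρ)).1
  | succ N ih =>
    obtain ⟨hp1, m, P, hP, hf⟩ := ih
    obtain ⟨-, Q, hQ, hv⟩ := IsProtocol.exists_attempt hρ F hF mF G hG mG i₀ j₀ hP
    refine ⟨hp1, n + m, Q, hQ, ?_⟩
    rw [hv, ebitFidelity_add, ebitFidelity_smul, hp]
    -- Success contributes at least `(1 - δ) p`, failure `1 - p` times the previous bound.
    have := mul_le_mul_of_nonneg_left hf (sub_nonneg.2 hp1)
    rw [pow_succ]
    linarith

theorem LOCCDistillable.lioccDistillable {ρ : Matrix (A × B) (A × B) ℂ} (hρ : IsDensity ρ)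
    (h : LOCCDistillable ρ) : LIOCCDistillable ρ := by
  intro ε hε
  -- The squared trace distance is at most twice the infidelity, so `ε ^ 2 / 4` is allotted to the
  -- imperfect filter and as much to running out of attempts.
  obtain ⟨n, K, L, hK, hL, h0, h1⟩ := h.exists_incoherent_branch hρ
    (δ := min (ε ^ 2 / 4) 1) (by positivity)
  set δ := min (ε ^ 2 / 4) 1
  obtain ⟨c, F, hc, hF0, hF, mF⟩ := hK.exists_measurement
  obtain ⟨d, G, hd, hG0, hG, mG⟩ := hL.exists_measurement
  have hS : localFilter (F none) (G none) (copies n ρ) =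
      ((c * c * (d * d) : ℝ) : ℂ) • localFilter K L (copies n ρ) := by
    rw [hF0, hG0, localFilter_smul_left, localFilter_smul_right, smul_smul]
    simp
  have hcd : 0 < c * c * (d * d) := by positivity
  have htr : (localFilter (F none) (G none) (copies n ρ)).trace.re =
      c * c * (d * d) * (localFilter K L (copies n ρ)).trace.re := by
    rw [hS, Matrix.trace_smul, smul_eq_mul, Complex.re_ofReal_mul]
  set p := c * c * (d * d) * (localFilter K L (copies n ρ)).trace.re with hp
  have hp0 : 0 < p := mul_pos hcd h0
  have key := exists_repeated_protocol hρ F hF mF G hG mG none none (δ := δ) htr (by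
    rw [hS, ebitFidelity_smul, hp]
    have := mul_le_mul_of_nonneg_left h1.le hcd.le
    linarith)
  have hp1 : p ≤ 1 := (key 0).1
  obtain ⟨N, hN⟩ := exists_pow_lt_of_lt_one (show 0 < ε ^ 2 / 4 by positivity)
    (show 1 - p < 1 by linarith)
  obtain ⟨-, m, P, hP, hf⟩ := key N
  refine ⟨m, P, hP, ?_⟩
  have hdist := traceDist_ebit_sq_le (hP.isDensity (copies_isDensity m hρ))
  refine le_of_sq_le_sq (hdist.trans ?_) hε.le
  have hδ1 : δ ≤ ε ^ 2 / 4 := min_le_left _ _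
  have hδ0 : 0 ≤ δ := by positivity
  have hpow : 0 ≤ (1 - p) ^ N := pow_nonneg (by linarith) N
  nlinarith [mul_nonneg hδ0 hpow]

end Repetition

theorem theorem7 {A B : Type} [Fintype A] [DecidableEq A] [Fintype B] [DecidableEq B]
    (ρ : Matrix (A × B) (A × B) ℂ) (hρ : IsDensity ρ) :
    LOCCDistillable ρ ↔ LIOCCDistillable ρ := by
  refine ⟨fun h => h.lioccDistillable hρ, fun h ε hε => ?_⟩
  obtain ⟨n, L, hL, hd⟩ := h ε hε
  exact ⟨n, L, hL.mono fun _ _ _ _ _ => trivial, hd⟩
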